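/- Let $f:\mathbb R\to[0,\infty)$ be a probability density with $f(-x)=f(x)$ for all $x$, let $F(x)=\int_{-\infty}^x f(t)\,dt$ and $\theta\in\mathbb R$, and let $X_1,X_2,\dots$ be i.i.d. real random variables with distribution function $x\mapsto F(x-\theta)$; write $E_\theta$ and $V_\theta$ for expectation and variance. Let $k:\mathbb R\to\mathbb R$ be an integrable (not necessarily nonnegative) kernel with $\int_{-\infty}^{\infty}k(u)\,du=1$, put $K(t)=\int_{-\infty}^{t}k(u)\,du$, and for a bandwidth $h_n$ define the smoothed sign statistic $$\widetilde S=n-n\widetilde F_n(0)=n-\sum_{i=1}^nK\!\left(-\frac{X_i}{h_n}\right),\qquad \widetilde F_n(x_0)=\frac1n\sum_{i=1}^nK\!\left(\frac{x_0-X_i}{h_n}\right).$$ **Theorem 1.** Assume that $f'$ exists and is continuous in a neighborhood of $-\theta$, and that $h_n=cn^{-d}$ with $c>0$ and $\frac14<d<\frac12$. If the kernel is symmetric around the origin, $k(-u)=k(u)$, and the limit $\lim_{n\to\infty}V_\theta\!\left[1-K\!\left(-X_1/h_n\right)\right]$ exists with $$0<\lim_{n\to\infty}V_\theta\!\left[1-K\!\left(-\frac{X_1}{h_n}\right)\right]<\infty,$$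 then $$\frac{\widetilde S-E_\theta(\widetilde S)}{\sqrt{V_\theta(\widetilde S)}}\longrightarrow N(0,1)\quad\text{in law as } n\to\infty.$$ -/

import Mathlib

open MeasureTheory ProbabilityTheory Filter Topology

noncomputable section

namespace SmoothedSign

/-- `f` is a probability density on the real line with `f (-x) = f x`. -/
structure IsSymmetricDensity (f : ℝ → ℝ) : Prop where
  nonneg : ∀ x, 0 ≤ f x
  integrable : Integrable f
  integral_eq_one : ∫ x, f x = 1
  symm : ∀ x, f (-x) = f x

/-- `k` is a symmetric kernel function: `∫ k = 1` and `k (-u) = k u`.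
It may take negative values, as higher order kernels do. -/
structure IsSymmetricKernel (k : ℝ → ℝ) : Prop where
  integrable : Integrable k
  integral_eq_one : ∫ u, k u = 1
  symm : ∀ u, k (-u) = k u

/-- The law with density `x ↦ f (x - θ)`; if `F` is the distribution function with density `f`,
this is the law with distribution function `x ↦ F (x - θ)`. -/
def locationLaw (f : ℝ → ℝ) (θ : ℝ) : Measure ℝ :=
  volume.withDensity fun x => ENNReal.ofReal (f (x - θ))

/-- The integrated kernel `K(t) = ∫_{-∞}^t k(u) du`. -/
def integratedKernel (k : ℝ → ℝ) (t : ℝ) : ℝ :=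
  ∫ u in Set.Iic t, k u

/-- The bandwidth `h_n = c n^{-d}`. -/
def bandwidth (c d : ℝ) (n : ℕ) : ℝ :=
  c * (n : ℝ) ^ (-d)

/-- The kernel estimator `n⁻¹ ∑_{i ≤ n} K((x₀ - X_i) / h)` of the distribution function at `x₀`,
from the first `n` observations and with bandwidth `h`. -/
def kernelDistEstimator {Ω : Type*} (k : ℝ → ℝ) (h : ℝ) (X : ℕ → Ω → ℝ) (n : ℕ) (x₀ : ℝ)
    (ω : Ω) : ℝ :=
  (1 / (n : ℝ)) * ∑ i ∈ Finset.range n, integratedKernel k ((x₀ - X i ω) / h)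

/-- The smoothed sign statistic `n - n F̃_n(0) = n - ∑_{i ≤ n} K(-X_i / h)`. -/
def smoothedSign {Ω : Type*} (k : ℝ → ℝ) (h : ℝ) (X : ℕ → Ω → ℝ) (n : ℕ) (ω : Ω) : ℝ :=
  (n : ℝ) - (n : ℝ) * kernelDistEstimator k h X n 0 ω

theorem smoothedSign_eq {Ω : Type*} (k : ℝ → ℝ) (h : ℝ) (X : ℕ → Ω → ℝ) (n : ℕ) (ω : Ω) :
    smoothedSign k h X n ω
      = (n : ℝ) - ∑ i ∈ Finset.range n, integratedKernel k (-X i ω / h) := by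
  rcases Nat.eq_zero_or_pos n with rfl | hn
  · simp [smoothedSign]
  · have hn' : (n : ℝ) ≠ 0 := by exact_mod_cast hn.ne'
    simp only [smoothedSign, kernelDistEstimator, zero_sub]
    rw [← mul_assoc, mul_one_div_cancel hn', one_mul]

end SmoothedSign

end

/-!
The smoothed sign statistic is the sum of the scores `g n (X i)`, where
`g n x = 1 - K (-x / h_n)`. Since `K` has limits `0` and `1` at `-∞` and `+∞` and `h_n → 0`, the
scores converge, at every `x ≠ 0`, to the score `1_{x > 0}` of the ordinary sign statistic
(`SmoothedSign.tendsto_score`), and they are bounded by `1 + ∫ |k|`. The law of the observations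
has a density, so `x = 0` does not matter, and dominated convergence gives
`Var[g n (X 0)] → Var[1_{X 0 > 0}]` and `Var[g n (X 0) - 1_{X 0 > 0}] → 0`
(`SmoothedSign.tendsto_variance_of_dominated`). The hypothesis that the limiting variance is
positive thus says that the ordinary sign score is not degenerate.

By independence and Chebyshev's inequality, the centered smoothed statistic divided by `√n`
differs from the ordinary one by a term that tends to zero in probability. The classical central
limit theorem for the indicators `1_{X i > 0}` and Slutsky's theorem, applied to the deterministic
normalizations, then give the claim (`SmoothedSign.tendstoInDistribution_sum_score`).
-/

namespace SmoothedSign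

theorem abs_integratedKernel_le {k : ℝ → ℝ} (hk : Integrable k) (t : ℝ) :
    |integratedKernel k t| ≤ ∫ u, |k u| :=
  (abs_integral_le_integral_abs).trans
    (setIntegral_le_integral hk.abs (ae_of_all _ fun _ => abs_nonneg _))

theorem tendsto_integratedKernel_atBot (k : ℝ → ℝ) :
    Tendsto (integratedKernel k) atBot (𝓝 0) :=
  tendsto_integral_Iic_zero tendsto_id

theorem tendsto_integratedKernel_atTop {k : ℝ → ℝ} (hk : Integrable k) :
    Tendsto (integratedKernel k) atTop (𝓝 (∫ u, k u)) := by
  have h := tendsto_setIntegral_of_monotone (μ := volume) (f := k)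
    (s := fun t : ℝ => Set.Iic t) (fun _ => measurableSet_Iic)
    (fun a b hab => Set.Iic_subset_Iic.2 hab) hk.integrableOn
  rwa [Set.iUnion_Iic, setIntegral_univ] at h

theorem continuous_integratedKernel {k : ℝ → ℝ} (hk : Integrable k) :
    Continuous (integratedKernel k) := by
  have h : integratedKernel k = fun t => (∫ u in Set.Iic 0, k u) + ∫ u in (0 : ℝ)..t, k u := by
    ext t
    rw [← intervalIntegral.integral_Iic_sub_Iic hk.integrableOn hk.integrableOn]
    simp [integratedKernel]
  rw [h]
  exact continuous_const.add
    (intervalIntegral.continuous_primitive (fun _ _ => hk.intervalIntegrable) 0)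

theorem bandwidth_pos {c : ℝ} (hc : 0 < c) (d : ℝ) {n : ℕ} (hn : 0 < n) :
    0 < bandwidth c d n :=
  mul_pos hc (Real.rpow_pos_of_pos (Nat.cast_pos.2 hn) _)

theorem tendsto_bandwidth (c : ℝ) {d : ℝ} (hd : 0 < d) :
    Tendsto (bandwidth c d) atTop (𝓝 0) := by
  have := ((tendsto_rpow_neg_atTop hd).comp tendsto_natCast_atTop_atTop).const_mul c
  rwa [mul_zero] at this

theorem tendsto_inv_bandwidth {c d : ℝ} (hc : 0 < c) (hd : 0 < d) :
    Tendsto (fun n => (bandwidth c d n)⁻¹) atTop atTop := by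
  refine tendsto_inv_nhdsGT_zero.comp (tendsto_nhdsWithin_iff.2 ⟨tendsto_bandwidth c hd, ?_⟩)
  filter_upwards [eventually_gt_atTop 0] with n hn using bandwidth_pos hc d hn

/-- As the bandwidth shrinks, the smoothed sign score `1 - K(-x / h_n)` converges to the plain
sign score, the indicator of `x > 0`, at every `x ≠ 0`. -/
theorem tendsto_score {k : ℝ → ℝ} (hk : IsSymmetricKernel k) {c d : ℝ} (hc : 0 < c) (hd : 0 < d)
    {x : ℝ} (hx : x ≠ 0) :
    Tendsto (fun n => 1 - integratedKernel k (-x / bandwidth c d n)) atTop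
      (𝓝 ((Set.Ioi (0 : ℝ)).indicator 1 x)) := by
  simp only [div_eq_mul_inv]
  rcases lt_or_gt_of_ne hx with h | h
  · have := (tendsto_integratedKernel_atTop hk.integrable).comp
      ((tendsto_inv_bandwidth hc hd).const_mul_atTop (neg_pos.2 h))
    rw [hk.integral_eq_one] at this
    simpa [h.not_gt, Function.comp_def] using this.const_sub 1
  · have := (tendsto_integratedKernel_atBot k).comp
      ((tendsto_inv_bandwidth hc hd).const_mul_atTop_of_neg (neg_lt_zero.2 h))
    simpa [h, Function.comp_def] using this.const_sub 1

theorem variance_sum_of_iIndepFun {Ω : Type*} [MeasurableSpace Ω] {P : Measure Ω}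
    {Y : ℕ → Ω → ℝ} (hY : ∀ i, MemLp (Y i) 2 P) (hindep : iIndepFun Y P)
    (hvar : ∀ i, Var[Y i; P] = Var[Y 0; P]) (n : ℕ) :
    Var[fun ω => ∑ i ∈ Finset.range n, Y i ω; P] = n * Var[Y 0; P] := by
  have := IndepFun.variance_sum (s := Finset.range n) (fun i _ => hY i)
    (fun i _ j _ hij => hindep.indepFun hij)
  rw [← Finset.sum_fn, this, Finset.sum_congr rfl fun i _ => hvar i]
  simp

section Probability

variable {Ω : Type*} [MeasurableSpace Ω] {P : Measure Ω} [IsProbabilityMeasure P]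

theorem tendsto_variance_of_dominated {Y : ℕ → Ω → ℝ} {Z : Ω → ℝ} {C : ℝ}
    (hY : ∀ n, AEMeasurable (Y n) P) (hC : ∀ n ω, |Y n ω| ≤ C)
    (hlim : ∀ᵐ ω ∂P, Tendsto (fun n => Y n ω) atTop (𝓝 (Z ω))) :
    Tendsto (fun n => Var[Y n; P]) atTop (𝓝 Var[Z; P]) := by
  have hZ : AEMeasurable Z P := aemeasurable_of_tendsto_metrizable_ae atTop hY hlim
  have hZC : ∀ᵐ ω ∂P, ‖Z ω‖ ≤ C := by
    filter_upwards [hlim] with ω hω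
    exact le_of_tendsto hω.norm (Eventually.of_forall fun n => hC n ω)
  have hY2 : ∀ n, MemLp (Y n) 2 P := fun n =>
    MemLp.of_bound (hY n).aestronglyMeasurable C (ae_of_all _ (hC n))
  have hZ2 : MemLp Z 2 P := MemLp.of_bound hZ.aestronglyMeasurable C hZC
  simp only [variance_eq_sub hZ2, fun n => variance_eq_sub (hY2 n)]
  refine Tendsto.sub ?_ (Tendsto.pow ?_ 2)
  · refine tendsto_integral_of_dominated_convergence (fun _ => C ^ 2)
      (fun n => ((hY n).pow_const 2).aestronglyMeasurable) (integrable_const _)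
      (fun n => ae_of_all _ fun ω => ?_) (hlim.mono fun ω h => h.pow 2)
    simpa using pow_le_pow_left₀ (abs_nonneg _) (hC n ω) 2
  · exact tendsto_integral_of_dominated_convergence (fun _ => C)
      (fun n => (hY n).aestronglyMeasurable) (integrable_const _)
      (fun n => ae_of_all _ (hC n)) hlim

theorem tendstoInMeasure_sub_integral_of_tendsto_variance {Y : ℕ → Ω → ℝ}
    (hY : ∀ n, MemLp (Y n) 2 P) (hvar : Tendsto (fun n => Var[Y n; P]) atTop (𝓝 0)) :
    TendstoInMeasure P (fun n ω => Y n ω - ∫ ω', Y n ω' ∂P) atTop 0 := by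
  rw [tendstoInMeasure_iff_norm]
  intro ε hε
  have hlim : Tendsto (fun n => ENNReal.ofReal (Var[Y n; P] / ε ^ 2)) atTop (𝓝 0) := by
    simpa using ENNReal.tendsto_ofReal (hvar.div_const (ε ^ 2))
  refine tendsto_of_tendsto_of_tendsto_of_le_of_le tendsto_const_nhds hlim (fun _ => zero_le)
    fun n => ?_
  simpa using meas_ge_le_variance_div_sq (hY n) hε

/-- **Central limit theorem** for uniformly bounded scores `g n` of an i.i.d. sequence that
converge almost everywhere to a score `g₀` with nonzero variance. The Lindeberg condition for
triangular arrays is not needed: the error made in replacing each `g n (X i)` by `g₀ (X i)`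
in the sum has variance `n * o(1)`, and vanishes after division by `√n`. -/
theorem tendstoInDistribution_sum_score {X : ℕ → Ω → ℝ} {μ : Measure ℝ}
    (hlaw : ∀ i, HasLaw (X i) μ P) (hindep : iIndepFun X P) {g : ℕ → ℝ → ℝ} {g₀ : ℝ → ℝ}
    (hg : ∀ n, Measurable (g n)) (hg₀ : Measurable g₀) {C : ℝ} (hC : ∀ n x, |g n x| ≤ C)
    (hC₀ : ∀ x, |g₀ x| ≤ C) (hlim : ∀ᵐ x ∂μ, Tendsto (fun n => g n x) atTop (𝓝 (g₀ x)))
    (hvar : Var[fun ω => g₀ (X 0 ω); P] ≠ 0) :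
    TendstoInDistribution
      (fun (n : ℕ) ω => (∑ i ∈ Finset.range n, g n (X i ω)
          - ∫ ω', ∑ i ∈ Finset.range n, g n (X i ω') ∂P)
        / √(Var[fun ω => ∑ i ∈ Finset.range n, g n (X i ω); P]))
      atTop (id : ℝ → ℝ) (fun _ => P) (gaussianReal 0 1) := by
  have hX : ∀ i, AEMeasurable (X i) P := fun i => (hlaw i).aemeasurable
  have hident : ∀ i, IdentDistrib (X i) (X 0) P P := fun i =>
    ⟨hX i, hX 0, (hlaw i).map_eq.trans (hlaw 0).map_eq.symm⟩
  have hmemLp : ∀ {r : ℝ → ℝ} {B : ℝ}, Measurable r → (∀ x, |r x| ≤ B) → ∀ i,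
      MemLp (fun ω => r (X i ω)) 2 P := fun hr hB i =>
    MemLp.of_bound (hr.comp_aemeasurable (hX i)).aestronglyMeasurable _
      (ae_of_all _ fun ω => hB _)
  have hsum : ∀ {r : ℝ → ℝ} {B : ℝ}, Measurable r → (∀ x, |r x| ≤ B) → ∀ n : ℕ,
      Var[fun ω => ∑ i ∈ Finset.range n, r (X i ω); P] = n * Var[fun ω => r (X 0 ω); P] :=
    fun hr hB n => variance_sum_of_iIndepFun (hmemLp hr hB)
      (hindep.comp (fun _ => _) fun _ => hr) (fun i => ((hident i).comp hr).variance_eq) n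
  have hlimX : ∀ᵐ ω ∂P, Tendsto (fun n => g n (X 0 ω)) atTop (𝓝 (g₀ (X 0 ω))) :=
    ae_of_ae_map (hX 0) ((hlaw 0).map_eq.symm ▸ hlim)
  have hV : Tendsto (fun n => Var[fun ω => g n (X 0 ω); P]) atTop
      (𝓝 Var[fun ω => g₀ (X 0 ω); P]) :=
    tendsto_variance_of_dominated (fun n => (hg n).comp_aemeasurable (hX 0))
      (fun n ω => hC n _) hlimX
  have hr : ∀ n, Measurable fun x => g n x - g₀ x := fun n => (hg n).sub hg₀
  have hrC : ∀ n x, |g n x - g₀ x| ≤ C + C := fun n x =>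
    (abs_sub _ _).trans (add_le_add (hC n x) (hC₀ x))
  have hR : Tendsto (fun n => Var[fun ω => g n (X 0 ω) - g₀ (X 0 ω); P]) atTop (𝓝 0) := by
    have := tendsto_variance_of_dominated (Y := fun n ω => g n (X 0 ω) - g₀ (X 0 ω))
      (Z := fun _ => 0)
      (fun n => (hr n).comp_aemeasurable (hX 0)) (fun n ω => hrC n (X 0 ω))
      (hlimX.mono fun ω h => by simpa using h.sub_const (g₀ (X 0 ω)))
    simpa [variance_eq_integral] using this
  have hσ : √Var[fun ω => g₀ (X 0 ω); P] ≠ 0 :=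
    (Real.sqrt_pos.2 (lt_of_le_of_ne (variance_nonneg _ _) hvar.symm)).ne'
  have hint : ∀ {r : ℝ → ℝ} {B : ℝ}, Measurable r → (∀ x, |r x| ≤ B) → ∀ n : ℕ,
      Integrable (fun ω => ∑ i ∈ Finset.range n, r (X i ω)) P := fun hr hB n =>
    integrable_finsetSum _ fun i _ => (hmemLp hr hB i).integrable (by norm_num)
  have hE₀ : ∀ n : ℕ, ∫ ω, ∑ i ∈ Finset.range n, g₀ (X i ω) ∂P
      = n * ∫ ω, g₀ (X 0 ω) ∂P := fun n => by
    rw [integral_finsetSum _ fun i _ => (hmemLp hg₀ hC₀ i).integrable (by norm_num),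
      Finset.sum_congr rfl fun i _ =>
        show ∫ ω, g₀ (X i ω) ∂P = ∫ ω, g₀ (X 0 ω) ∂P from ((hident i).comp hg₀).integral_eq]
    simp
  have hY : HasLaw (fun y => √Var[fun ω => g₀ (X 0 ω); P] * y)
      (gaussianReal 0 Var[fun ω => g₀ (X 0 ω); P].toNNReal) (gaussianReal 0 1) := by
    refine ⟨by fun_prop, ?_⟩
    rw [gaussianReal_map_const_mul]
    congr 1
    · simp
    · ext
      simp [Real.sq_sqrt (variance_nonneg _ _), variance_nonneg]
  have hclt := tendstoInDistribution_inv_sqrt_mul_sum_sub (X := fun i ω => g₀ (X i ω)) hY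
    (hmemLp hg₀ hC₀ 0) (hindep.comp (fun _ => g₀) fun _ => hg₀) fun i => (hident i).comp hg₀
  have hmeas : ∀ n : ℕ, AEMeasurable (fun ω => (√(n : ℝ))⁻¹ * (∑ i ∈ Finset.range n, g n (X i ω)
      - ∫ ω', ∑ i ∈ Finset.range n, g n (X i ω') ∂P)) P := fun n =>
    ((hint (hg n) (hC n) n).aemeasurable.sub_const _).const_mul _
  -- The normalized error `(√n)⁻¹ ∑ (g n - g₀)(X i)` has variance `Var[(g n - g₀)(X 0)] → 0`.
  have herr : TendstoInMeasure P
      ((fun (n : ℕ) ω => (√(n : ℝ))⁻¹ * (∑ i ∈ Finset.range n, g n (X i ω)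
        - ∫ ω', ∑ i ∈ Finset.range n, g n (X i ω') ∂P))
      - fun (n : ℕ) ω => (√(n : ℝ))⁻¹ * (∑ i ∈ Finset.range n, g₀ (X i ω)
        - n * ∫ ω', g₀ (X 0 ω') ∂P)) atTop 0 := by
    have h := tendstoInMeasure_sub_integral_of_tendsto_variance (P := P)
      (Y := fun n ω => (√(n : ℝ))⁻¹ * ∑ i ∈ Finset.range n, (g n (X i ω) - g₀ (X i ω)))
      (fun n => (memLp_finsetSum _ fun i _ => hmemLp (hr n) (hrC n) i).const_mul _) ?_
    · convert! h using 3 with n ω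
      have hEsub : ∫ ω', ∑ i ∈ Finset.range n, (g n (X i ω') - g₀ (X i ω')) ∂P
          = ∫ ω', ∑ i ∈ Finset.range n, g n (X i ω') ∂P - n * ∫ ω', g₀ (X 0 ω') ∂P := by
        simp only [Finset.sum_sub_distrib]
        rw [integral_sub (hint (hg n) (hC n) n) (hint hg₀ hC₀ n), hE₀]
      rw [integral_const_mul, hEsub]
      simp only [Pi.sub_apply, Finset.sum_sub_distrib]
      ring
    · refine hR.congr' ?_
      filter_upwards [eventually_gt_atTop 0] with n hn
      have hn' : (0 : ℝ) < n := Nat.cast_pos.2 hn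
      rw [variance_const_mul, hsum (hr n) (hrC n), inv_pow, Real.sq_sqrt hn'.le,
        inv_mul_cancel_left₀ hn'.ne']
  have hU := tendstoInDistribution_of_tendstoInMeasure_sub _ _ hclt herr hmeas
  -- Slutsky's theorem replaces the limiting normalization by the actual standard deviation.
  have hfin := hU.continuous_comp_prodMk_of_tendstoInMeasure_const
    (Y := fun n _ => (√Var[fun ω => g n (X 0 ω); P])⁻¹)
    (c := (√Var[fun ω => g₀ (X 0 ω); P])⁻¹) (g := fun p : ℝ × ℝ => p.1 * p.2)
    (by fun_prop)
    (tendstoInMeasure_of_tendsto_ae (fun n => aestronglyMeasurable_const)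
      (ae_of_all _ fun _ => hV.sqrt.inv₀ hσ))
    fun n => aemeasurable_const
  refine hfin.congr (fun n => ae_of_all _ fun ω => ?_) (ae_of_all _ fun y => ?_)
  · simp only [hsum (hg n) (hC n) n, Real.sqrt_mul (Nat.cast_nonneg n)]
    rw [div_eq_mul_inv, mul_inv]
    ring
  · simp only [id]
    field_simp

end Probability

theorem smoothedSign_eq_sum {Ω : Type*} (k : ℝ → ℝ) (h : ℝ) (X : ℕ → Ω → ℝ) (n : ℕ) :
    smoothedSign k h X n
      = fun ω => ∑ i ∈ Finset.range n, (1 - integratedKernel k (-X i ω / h)) := by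
  ext ω
  simp [smoothedSign_eq]

end SmoothedSign

theorem theorem1 {Ω : Type*} [MeasurableSpace Ω] (P : Measure Ω) [IsProbabilityMeasure P]
    (f : ℝ → ℝ) (hf : SmoothedSign.IsSymmetricDensity f) (θ : ℝ)
    (hf' : ∀ᶠ x in 𝓝 (-θ), DifferentiableAt ℝ f x ∧ ContinuousAt (deriv f) x)
    (X : ℕ → Ω → ℝ) (hlaw : ∀ i, HasLaw (X i) (SmoothedSign.locationLaw f θ) P)
    (hindep : iIndepFun X P)
    (k : ℝ → ℝ) (hk : SmoothedSign.IsSymmetricKernel k)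
    (c d : ℝ) (hc : 0 < c) (hd : 1 / 4 < d) (hd' : d < 1 / 2)
    (hvar : ∃ v : ℝ, 0 < v ∧
      Tendsto (fun n : ℕ => Var[fun ω => 1 - SmoothedSign.integratedKernel k
        (-X 0 ω / SmoothedSign.bandwidth c d n); P]) atTop (𝓝 v)) :
    TendstoInDistribution
      (fun (n : ℕ) (ω : Ω) =>
        (SmoothedSign.smoothedSign k (SmoothedSign.bandwidth c d n) X n ω
            - ∫ ω', SmoothedSign.smoothedSign k (SmoothedSign.bandwidth c d n) X n ω' ∂P)
          / √(Var[SmoothedSign.smoothedSign k (SmoothedSign.bandwidth c d n) X n; P]))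
      atTop (id : ℝ → ℝ) (fun _ => P) (gaussianReal 0 1) := by
  obtain ⟨v, hv, hlim⟩ := hvar
  have hd0 : 0 < d := by linarith
  have hg : ∀ n, Measurable fun x =>
      1 - SmoothedSign.integratedKernel k (-x / SmoothedSign.bandwidth c d n) := fun n =>
    ((SmoothedSign.continuous_integratedKernel hk.integrable).comp
      (continuous_neg.div_const _)).measurable.const_sub 1
  have hC : ∀ n x, |1 - SmoothedSign.integratedKernel k (-x / SmoothedSign.bandwidth c d n)|
      ≤ 1 + ∫ u, |k u| := fun n x =>
    (abs_sub _ _).trans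
      (add_le_add abs_one.le (SmoothedSign.abs_integratedKernel_le hk.integrable _))
  have hg₀ : Measurable ((Set.Ioi (0 : ℝ)).indicator (1 : ℝ → ℝ)) :=
    measurable_one.indicator measurableSet_Ioi
  have hC₀ : ∀ x, |(Set.Ioi (0 : ℝ)).indicator (1 : ℝ → ℝ) x| ≤ 1 + ∫ u, |k u| := fun x => by
    have : 0 ≤ ∫ u, |k u| := integral_nonneg fun _ => abs_nonneg _
    by_cases hx : x ∈ Set.Ioi (0 : ℝ) <;> simp [hx] <;> linarith
  -- The location law has a density, so the exceptional point `0` is negligible.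
  have hlimg : ∀ᵐ x ∂(SmoothedSign.locationLaw f θ), Tendsto
      (fun n => 1 - SmoothedSign.integratedKernel k (-x / SmoothedSign.bandwidth c d n)) atTop
      (𝓝 ((Set.Ioi (0 : ℝ)).indicator 1 x)) := by
    have h0 : ∀ᵐ x ∂(SmoothedSign.locationLaw f θ), x ≠ 0 :=
      (withDensity_absolutelyContinuous volume _).ae_le (Measure.ae_ne volume 0)
    exact h0.mono fun x hx => SmoothedSign.tendsto_score hk hc hd0 hx
  have hlimX := ae_of_ae_map (hlaw 0).aemeasurable ((hlaw 0).map_eq.symm ▸ hlimg)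
  -- The variance of the limiting score is the limit of the variances, hence positive.
  have hv₀ : Var[fun ω => (Set.Ioi (0 : ℝ)).indicator (1 : ℝ → ℝ) (X 0 ω); P] ≠ 0 := by
    rw [tendsto_nhds_unique (SmoothedSign.tendsto_variance_of_dominated
      (fun n => (hg n).comp_aemeasurable (hlaw 0).aemeasurable) (fun n ω => hC n _) hlimX) hlim]
    exact hv.ne'
  simp only [SmoothedSign.smoothedSign_eq_sum]
  exact SmoothedSign.tendstoInDistribution_sum_score hlaw hindep hg hg₀ hC hC₀ hlimg hv₀
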